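/- Let $d, n$ be natural numbers. For $\alpha\in\mathbb{R}^d$ let $T_\alpha f=f(\cdot-\alpha)$ and $E_\alpha f=e^{2\pi i\langle\alpha,\cdot\rangle}f$ on $L^2(\mathbb{R}^d)$ (complex valued, Lebesgue measure $\lambda$), and let $\hat f$ be the $L^2$ Fourier transform, given by $\hat f(\xi)=\int e^{-2\pi i\langle\xi,x\rangle}f(x)\,dx$ for $f\in L^1\cap L^2$. A family $(x_i)_{i\in I}$ in a Hilbert space $H$ is a frame for $H$ if there are constants $C_1>0$ and $C_2<\infty$ with $C_1\|h\|^2\le\sum_{i}|\langle h,x_i\rangle|^2\le C_2\|h\|^2$ for all $h\in H$; its analysis operator is $\Theta:H\to\ell^2(I)$, $\Theta h=(\langle h,x_i\rangle)_{i\in I}$. Let $A,X,B,Y$ be nonsingular real $d\times d$ matrices and $f_1,\dots,f_n,g_1,\dots,g_n\in L^2(\mathbb{R}^d)$, and suppose that the families $\{E_{Al}T_{Xz}f_j\}$ and $\{E_{Bl}T_{Yz}g_j\}$, both indexed by $(j,l,z)\in\{1,\dots,n\}\times\mathbb{Z}^d\times\mathbb{Z}^d$, are frames for $L^2(\mathbb{R}^d)$,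 with analysis operators $\Theta_F$ and $\Theta_G$ into $\ell^2(\{1,\dots,n\}\times\mathbb{Z}^d\times\mathbb{Z}^d)$. Write $M^{*}$ for the transpose of $M$ and $M^{*-1}$ for its inverse, and for $\xi\in\mathbb{R}^d$ define $$m_j(\xi)=\sum_{k\in\mathbb{Z}^d}|\hat f_j(X^{*-1}(\xi+k))|^2,\qquad n_j(\xi)=\sum_{k\in\mathbb{Z}^d}|\hat g_j(Y^{*-1}(\xi+k))|^2,$$ $$\tilde m_j(\xi)=\sum_{k\in\mathbb{Z}^d}|f_j(A^{*-1}(\xi+k))|^2,\qquad \tilde n_j(\xi)=\sum_{k\in\mathbb{Z}^d}|g_j(B^{*-1}(\xi+k))|^2.$$ Let $E_j,F_j,\tilde E_j,\tilde F_j\subset\mathbb{R}^d$ be the sets where $m_j,n_j,\tilde m_j,\tilde n_j$, respectively, do not vanish (they are determined up to null sets). Then: 1. if $\Theta_F(L^2(\mathbb{R}^d))\subset\Theta_G(L^2(\mathbb{R}^d))$, then $\lambda(E_j\setminus F_j)=0$ and $\lambda(\tilde E_j\setminus\tilde F_j)=0$ for $j=1,\dots,n$; 2. if $\Theta_F(L^2(\mathbb{R}^d))=\Theta_G(L^2(\mathbb{R}^d))$,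 then $\lambda(E_j\,\Delta\,F_j)=0$ and $\lambda(\tilde E_j\,\Delta\,\tilde F_j)=0$ for $j=1,\dots,n$; 3. if $\lambda(E_j\cap F_j)=0$ for $j=1,\dots,n$, then $\Theta_F(L^2(\mathbb{R}^d))\perp\Theta_G(L^2(\mathbb{R}^d))$; 4. if $X^{*}A=Y^{*}B$ and $\lambda(\tilde E_j\cap\tilde F_j)=0$ for $j=1,\dots,n$, then $\Theta_F(L^2(\mathbb{R}^d))\perp\Theta_G(L^2(\mathbb{R}^d))$. -/

import Mathlib

open MeasureTheory
open scoped FourierTransform Matrix ENNReal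

noncomputable section

namespace WeylHeisenberg

/-! ### Frames and analysis operators -/

section Frames

variable {H : Type*} [NormedAddCommGroup H] [InnerProductSpace ℂ H] {ι : Type*}

/-- The family `x` is a frame for `H`: with constants `0 < C₁` and `C₂ < ∞`,
`C₁ ‖h‖² ≤ ∑ |⟨h, x i⟩|² ≤ C₂ ‖h‖²` for all `h`. -/
def IsFrame (x : ι → H) : Prop :=
  ∃ C₁ C₂ : ℝ, 0 < C₁ ∧ ∀ h : H,
    Summable (fun i => ‖inner ℂ (x i) h‖ ^ 2) ∧
    C₁ * ‖h‖ ^ 2 ≤ ∑' i, ‖inner ℂ (x i) h‖ ^ 2 ∧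
    ∑' i, ‖inner ℂ (x i) h‖ ^ 2 ≤ C₂ * ‖h‖ ^ 2

theorem IsFrame.memlp {x : ι → H} (hx : IsFrame x) (h : H) :
    Memℓp (fun i => inner ℂ (x i) h) (2 : ℝ≥0∞) := by
  obtain ⟨C₁, C₂, -, hC⟩ := hx
  refine memℓp_gen ?_
  simpa using (hC h).1

/-- The analysis operator `h ↦ (⟨h, x i⟩)_i` of a frame, from `H` to `ℓ²(ι)`. The inner product
`⟨h, x i⟩`, linear in `h`, is written `inner ℂ (x i) h` in Mathlib. -/
def analysis (x : ι → H) (hx : IsFrame x) : H →ₗ[ℂ] lp (fun _ : ι => ℂ) (2 : ℝ≥0∞) where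
  toFun h := ⟨fun i => inner ℂ (x i) h, hx.memlp h⟩
  map_add' h k := by
    ext i
    exact inner_add_right _ _ _
  map_smul' c h := by
    ext i
    exact inner_smul_right _ _ _

end Frames

/-! ### Translations, modulations and Weyl-Heisenberg systems -/

variable {d n : ℕ}

/-- `L²(ℝᵈ)`, complex valued, with Lebesgue measure. -/
abbrev L2 (d : ℕ) : Type :=
  Lp ℂ 2 (volume : Measure (EuclideanSpace ℝ (Fin d)))

/-- The vector `M v` of `ℝᵈ`, for a real `d × d` matrix `M` and `v ∈ ℝᵈ`. -/
def mulV (M : Matrix (Fin d) (Fin d) ℝ) (v : EuclideanSpace ℝ (Fin d)) :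
    EuclideanSpace ℝ (Fin d) :=
  WithLp.toLp 2 (M *ᵥ v.ofLp)

/-- A point of `ℤᵈ` as a vector of `ℝᵈ`. -/
def intV (k : Fin d → ℤ) : EuclideanSpace ℝ (Fin d) :=
  WithLp.toLp 2 (fun i => (k i : ℝ))

/-- Translation: `T_a f = f(· - a)`. -/
def transl (a : EuclideanSpace ℝ (Fin d)) (f : L2 d) : L2 d :=
  Lp.compMeasurePreserving (fun x => x - a) (measurePreserving_sub_right volume a) f

/-- The function `x ↦ e^{2πi⟨a, x⟩} f(x)`. -/
def modulateFun (a : EuclideanSpace ℝ (Fin d)) (f : EuclideanSpace ℝ (Fin d) → ℂ)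
    (x : EuclideanSpace ℝ (Fin d)) : ℂ :=
  Complex.exp (2 * Real.pi * Complex.I * ((inner ℝ a x : ℝ) : ℂ)) * f x

theorem memLp_modulateFun (a : EuclideanSpace ℝ (Fin d)) (f : L2 d) :
    MemLp (modulateFun a f) 2 (volume : Measure (EuclideanSpace ℝ (Fin d))) := by
  have hc : Continuous fun x : EuclideanSpace ℝ (Fin d) =>
      Complex.exp (2 * Real.pi * Complex.I * ((inner ℝ a x : ℝ) : ℂ)) := by fun_prop
  refine (Lp.memLp f).of_le (hc.aestronglyMeasurable.mul (Lp.memLp f).1) ?_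
  refine Filter.Eventually.of_forall fun x => le_of_eq ?_
  have h1 : (2 * Real.pi * Complex.I * ((inner ℝ a x : ℝ) : ℂ))
      = ((2 * Real.pi * inner ℝ a x : ℝ) : ℂ) * Complex.I := by
    push_cast; ring
  rw [modulateFun, norm_mul, h1, Complex.norm_exp_ofReal_mul_I, one_mul]

/-- Modulation: `E_a f = e^{2πi⟨a, ·⟩} f`. -/
def modulate (a : EuclideanSpace ℝ (Fin d)) (f : L2 d) : L2 d :=
  (memLp_modulateFun a f).toLp

/-- The Weyl-Heisenberg system `E_{Al} T_{Xz} f_j`, indexed by `(j, l, z)`. -/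
def whSystem (A X : Matrix (Fin d) (Fin d) ℝ) (f : Fin n → L2 d) :
    Fin n × (Fin d → ℤ) × (Fin d → ℤ) → L2 d :=
  fun p => modulate (mulV A (intV p.2.1)) (transl (mulV X (intV p.2.2)) (f p.1))

/-! ### Periodizations and their supports -/

/-- `ξ ↦ ∑_{k ∈ ℤᵈ} |φ(M*⁻¹(ξ + k))|²`, with values in `[0, ∞]`. -/
def periodization (M : Matrix (Fin d) (Fin d) ℝ) (φ : L2 d) (ξ : EuclideanSpace ℝ (Fin d)) :
    ℝ≥0∞ :=
  ∑' k : Fin d → ℤ, ‖φ (mulV (Mᵀ)⁻¹ (ξ + intV k))‖ₑ ^ 2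

/-- The set where the periodization does not vanish. Another representative of `φ` changes it by
a null set only, if `M` is nonsingular. -/
def periodSupport (M : Matrix (Fin d) (Fin d) ℝ) (φ : L2 d) : Set (EuclideanSpace ℝ (Fin d)) :=
  Function.support (periodization M φ)

end WeylHeisenberg

end

open Filter Topology
open scoped ComplexConjugate

noncomputable section

namespace WeylHeisenberg

/-! ### Functions on `ℝᵈ` and the torus -/

section Torus

-- For fixed `(j, l)`, the conjugated coefficients `⟨E_{Al} T_{Xz} f_j, h⟩` are, by Plancherel, the
-- Fourier coefficients in `z` of the complex measure `conj(ĥ(x)) f̂_j(x - Al) dx` pushed forward to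
-- the torus under `x ↦ X*(x - Al)` mod `ℤᵈ`. Up to null sets this image lives over `E_j`. For fixed
-- `(j, z)` the coefficients in `l` behave alike, with `f_j`, `A` and `Ẽ_j` in place of `f̂_j`, `X`
-- and `E_j`, up to the phase `e^{-2πi⟨Al, Xz⟩}`. Both families are thus compared on one torus,
-- although their matrices differ.
--
-- Inclusion: if `Θ_G h = Θ_F f_j`, the indices with `l = 0` show that `|f̂_j|²` and `conj(ĥ) ĝ_j`
-- have the same image on the torus (`setIntegral_preimage_eq_of_coeff_eq`). The second image does
-- not charge the complement of `F_j`, so `f̂_j` vanishes over `E_j \ F_j`, which forces that set to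
-- be null. The indices with `z = 0` treat `Ẽ_j \ F̃_j`.
--
-- Orthogonality: the slices are square-summable, so the images have `L²` densities. Over disjoint
-- supports Parseval makes each slice of the inner product zero (`tsum_conj_mul_coeff_eq_zero`). In
-- the time version the condition `X*A = Y*B` makes the two phases equal, and they cancel.

local instance : MeasureSpace UnitAddCircle := ⟨AddCircle.haarAddCircle⟩

local instance : IsProbabilityMeasure (volume : Measure UnitAddCircle) :=
  inferInstanceAs (IsProbabilityMeasure AddCircle.haarAddCircle)

variable {d : ℕ}

/-- The quotient map from `ℝᵈ` to the torus `(ℝ / ℤ)ᵈ`. -/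
def toTorus (v : EuclideanSpace ℝ (Fin d)) : UnitAddTorus (Fin d) :=
  fun i => ((v i : ℝ) : UnitAddCircle)

theorem measurable_toTorus : Measurable (toTorus (d := d)) :=
  measurable_pi_lambda _ fun i => AddCircle.measurable_mk'.comp (by fun_prop)

theorem mFourier_toTorus (k : Fin d → ℤ) (v : EuclideanSpace ℝ (Fin d)) :
    UnitAddTorus.mFourier k (toTorus v) =
      Complex.exp (2 * Real.pi * Complex.I * ((inner ℝ (intV k) v : ℝ) : ℂ)) := by
  simp only [UnitAddTorus.mFourier, ContinuousMap.coe_mk, toTorus, fourier_coe_apply]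
  rw [← Complex.exp_sum]
  congr 1
  simp only [PiLp.inner_apply, intV, RCLike.inner_apply, conj_trivial, Complex.ofReal_sum,
    Complex.ofReal_mul, Finset.mul_sum]
  refine Finset.sum_congr rfl fun i _ => ?_
  push_cast
  ring

/-- A measurable set of `ℝᵈ` that is invariant under `ℤᵈ` comes from a measurable set of the
torus. -/
theorem exists_toTorus_preimage_eq {s : Set (EuclideanSpace ℝ (Fin d))} (hs : MeasurableSet s)
    (hper : ∀ (k : Fin d → ℤ) (v), v + intV k ∈ s ↔ v ∈ s) :
    ∃ t : Set (UnitAddTorus (Fin d)), MeasurableSet t ∧ toTorus ⁻¹' t = s := by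
  -- A measurable section of the quotient map, with values in `(0, 1]ᵈ`. Since `σ (toTorus v)`
  -- differs from `v` by an integer vector, an invariant `s` is the preimage of `σ ⁻¹' s`.
  let σ : UnitAddTorus (Fin d) → EuclideanSpace ℝ (Fin d) := fun x =>
    WithLp.toLp 2 fun i => (AddCircle.measurableEquivIoc 1 (0 : ℝ) (x i) : ℝ)
  have hσ : Measurable σ := by
    refine (WithLp.measurable_toLp 2 _).comp (measurable_pi_lambda _ fun i => ?_)
    exact measurable_subtype_coe.comp
      ((AddCircle.measurableEquivIoc 1 (0 : ℝ)).measurable.comp (measurable_pi_apply i))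
  refine ⟨σ ⁻¹' s, hσ hs, ?_⟩
  ext v
  have hv : ∃ k : Fin d → ℤ, σ (toTorus v) = v + intV k := by
    have h1 : ∀ i, ∃ k : ℤ,
        (AddCircle.measurableEquivIoc 1 (0 : ℝ) ((v i : ℝ) : UnitAddCircle) : ℝ) = v i + k := by
      intro i
      have h2 : (((AddCircle.measurableEquivIoc 1 (0 : ℝ) ((v i : ℝ) : UnitAddCircle) : ℝ)) :
          UnitAddCircle) = ((v i : ℝ) : UnitAddCircle) :=
        (AddCircle.equivIoc 1 (0 : ℝ)).symm_apply_apply _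
      rw [← sub_eq_zero, ← AddCircle.coe_sub, AddCircle.coe_eq_zero_iff] at h2
      obtain ⟨k, hk⟩ := h2
      refine ⟨k, ?_⟩
      rw [zsmul_one] at hk
      linarith
    choose k hk using h1
    refine ⟨k, ?_⟩
    ext i
    simpa [σ, intV, toTorus] using hk i
  obtain ⟨k, hk⟩ := hv
  simp only [Set.mem_preimage, hk, hper]

/-! ### Uniqueness of Fourier coefficients for measures pushed forward to the torus -/

section Uniqueness

variable {Ω₁ Ω₂ : Type*} [MeasurableSpace Ω₁] [MeasurableSpace Ω₂] {μ₁ : Measure Ω₁}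
  {μ₂ : Measure Ω₂} {p₁ : Ω₁ → UnitAddTorus (Fin d)} {p₂ : Ω₂ → UnitAddTorus (Fin d)}
  {w₁ : Ω₁ → ℂ} {w₂ : Ω₂ → ℂ}

theorem integrable_continuousMap_mul (hp₁ : Measurable p₁) (hw₁ : Integrable w₁ μ₁)
    (φ : C(UnitAddTorus (Fin d), ℂ)) : Integrable (fun x => φ (p₁ x) * w₁ x) μ₁ :=
  hw₁.bdd_mul (φ.continuous.measurable.comp hp₁).aestronglyMeasurable
    (Eventually.of_forall fun x => φ.norm_coe_le_norm (p₁ x))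

/-- Integration against a fixed integrable function, pulled back from the torus. -/
def integralCLM (hp₁ : Measurable p₁) (hw₁ : Integrable w₁ μ₁) :
    C(UnitAddTorus (Fin d), ℂ) →L[ℂ] ℂ :=
  LinearMap.mkContinuous
    { toFun := fun φ => ∫ x, φ (p₁ x) * w₁ x ∂μ₁
      map_add' := fun φ ψ => by
        rw [← integral_add (integrable_continuousMap_mul hp₁ hw₁ φ)
          (integrable_continuousMap_mul hp₁ hw₁ ψ)]
        simp only [ContinuousMap.add_apply, add_mul]
      map_smul' := fun c φ => by
        simp only [ContinuousMap.smul_apply, smul_eq_mul, mul_assoc, RingHom.id_apply]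
        exact integral_const_mul _ _ }
    (∫ x, ‖w₁ x‖ ∂μ₁) fun φ => by
      rw [mul_comm, ← integral_const_mul]
      refine norm_integral_le_of_norm_le (hw₁.norm.const_mul _) (Eventually.of_forall fun x => ?_)
      rw [norm_mul]
      exact mul_le_mul_of_nonneg_right (φ.norm_coe_le_norm _) (norm_nonneg _)

/-- Both sides are continuous in `φ` for the uniform norm, and trigonometric polynomials are dense.
-/
theorem integral_continuousMap_mul_eq (hp₁ : Measurable p₁) (hp₂ : Measurable p₂)
    (hw₁ : Integrable w₁ μ₁) (hw₂ : Integrable w₂ μ₂)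
    (h : ∀ k : Fin d → ℤ, ∫ x, UnitAddTorus.mFourier (-k) (p₁ x) * w₁ x ∂μ₁ =
      ∫ x, UnitAddTorus.mFourier (-k) (p₂ x) * w₂ x ∂μ₂) (φ : C(UnitAddTorus (Fin d), ℂ)) :
    ∫ x, φ (p₁ x) * w₁ x ∂μ₁ = ∫ x, φ (p₂ x) * w₂ x ∂μ₂ := by
  have hd : Dense (Submodule.span ℂ
      (Set.range (UnitAddTorus.mFourier (d := Fin d))) : Set C(UnitAddTorus (Fin d), ℂ)) :=
    Submodule.dense_iff_topologicalClosure_eq_top.2 UnitAddTorus.span_mFourier_closure_eq_top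
  have hext : integralCLM hp₁ hw₁ = integralCLM hp₂ hw₂ := by
    refine ContinuousLinearMap.ext_on hd ?_
    rintro _ ⟨k, rfl⟩
    have hk := h (-k)
    rw [neg_neg] at hk
    exact hk
  exact DFunLike.congr_fun hext φ

/-- The indicator of a closed set is a pointwise limit of continuous functions bounded by `1`, so
dominated convergence applies with bound `‖w₁‖`. -/
theorem setIntegral_isClosed_tendsto (hp₁ : Measurable p₁) (hw₁ : Integrable w₁ μ₁)
    {s : Set (UnitAddTorus (Fin d))} (hs : IsClosed s) :
    Tendsto (fun m => ∫ x, (((hs.apprSeq m (p₁ x) : NNReal) : ℝ) : ℂ) * w₁ x ∂μ₁) atTop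
      (𝓝 (∫ x in p₁ ⁻¹' s, w₁ x ∂μ₁)) := by
  rw [← integral_indicator (hp₁ hs.measurableSet)]
  refine tendsto_integral_of_dominated_convergence (fun x => ‖w₁ x‖) ?_ hw₁.norm ?_ ?_
  · intro m
    refine AEStronglyMeasurable.mul (Measurable.aestronglyMeasurable ?_) hw₁.1
    exact Complex.measurable_ofReal.comp (measurable_coe_nnreal_real.comp
      ((hs.apprSeq m).continuous.measurable.comp hp₁))
  · intro m
    refine Eventually.of_forall fun x => ?_
    rw [norm_mul]
    refine mul_le_of_le_one_left (norm_nonneg _) ?_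
    simpa using HasOuterApproxClosed.apprSeq_apply_le_one hs m (p₁ x)
  · refine Eventually.of_forall fun x => ?_
    have h1 := (tendsto_pi_nhds.1 (HasOuterApproxClosed.tendsto_apprSeq hs)) (p₁ x)
    have h2 : Tendsto (fun m => (((hs.apprSeq m (p₁ x) : NNReal) : ℝ) : ℂ) * w₁ x) atTop
        (𝓝 ((((s.indicator (fun _ => (1 : NNReal)) (p₁ x) : NNReal) : ℝ) : ℂ) * w₁ x)) :=
      (((Complex.continuous_ofReal.comp NNReal.continuous_coe).tendsto _).comp h1).mul_const _
    convert h2 using 2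
    by_cases hx : p₁ x ∈ s <;> simp [Set.indicator, hx]

/-- Integrable functions on spaces over the torus with the same Fourier coefficients have the same
integrals over preimages of measurable sets. -/
theorem setIntegral_preimage_eq_of_coeff_eq (hp₁ : Measurable p₁) (hp₂ : Measurable p₂)
    (hw₁ : Integrable w₁ μ₁) (hw₂ : Integrable w₂ μ₂)
    (h : ∀ k : Fin d → ℤ, ∫ x, UnitAddTorus.mFourier (-k) (p₁ x) * w₁ x ∂μ₁ =
      ∫ x, UnitAddTorus.mFourier (-k) (p₂ x) * w₂ x ∂μ₂)
    {s : Set (UnitAddTorus (Fin d))} (hs : MeasurableSet s) :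
    ∫ x in p₁ ⁻¹' s, w₁ x ∂μ₁ = ∫ x in p₂ ⁻¹' s, w₂ x ∂μ₂ := by
  have hcl : ∀ s : Set (UnitAddTorus (Fin d)), IsClosed s →
      ∫ x in p₁ ⁻¹' s, w₁ x ∂μ₁ = ∫ x in p₂ ⁻¹' s, w₂ x ∂μ₂ := by
    intro s hs
    refine tendsto_nhds_unique (setIntegral_isClosed_tendsto hp₁ hw₁ hs) ?_
    convert setIntegral_isClosed_tendsto hp₂ hw₂ hs using 2 with m
    exact integral_continuousMap_mul_eq hp₁ hp₂ hw₁ hw₂ h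
      ⟨fun t => (((hs.apprSeq m t : NNReal) : ℝ) : ℂ), by fun_prop⟩
  have huniv : ∫ x, w₁ x ∂μ₁ = ∫ x, w₂ x ∂μ₂ := by
    simpa using hcl Set.univ isClosed_univ
  -- Closed sets form a π-system generating the Borel sets. The complement step needs equal total
  -- integrals, which is `huniv`.
  induction s, hs using MeasurableSpace.induction_on_inter
    (borel_eq_generateFrom_isClosed (α := UnitAddTorus (Fin d)) ▸ BorelSpace.measurable_eq)
    isPiSystem_isClosed with
  | empty => simp
  | basic t ht => exact hcl t ht
  | compl t ht ih =>
    rw [Set.preimage_compl, Set.preimage_compl, setIntegral_compl (hp₁ ht) hw₁,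
      setIntegral_compl (hp₂ ht) hw₂, ih, huniv]
  | iUnion f hd hf ih =>
    rw [Set.preimage_iUnion, Set.preimage_iUnion,
      integral_iUnion (fun i => hp₁ (hf i)) (fun i j hij => (hd hij).preimage p₁) hw₁.integrableOn,
      integral_iUnion (fun i => hp₂ (hf i)) (fun i j hij => (hd hij).preimage p₂) hw₂.integrableOn]
    exact tsum_congr ih

/-- The function on the torus with given square-summable Fourier coefficients. -/
theorem exists_lp_mFourierCoeff_eq {c : (Fin d → ℤ) → ℂ} (hc : Summable fun k => ‖c k‖ ^ 2) :
    ∃ D : Lp ℂ 2 (volume : Measure (UnitAddTorus (Fin d))),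
      ∀ k, UnitAddTorus.mFourierCoeff D k = c k := by
  have hm : Memℓp c (2 : ℝ≥0∞) := memℓp_gen (by simpa using hc)
  refine ⟨UnitAddTorus.mFourierBasis.repr.symm ⟨c, hm⟩, fun k => ?_⟩
  rw [← UnitAddTorus.mFourierBasis_repr, LinearIsometryEquiv.apply_symm_apply]

/-- By uniqueness `D` is the density of the image of `w₁ μ₁` on the torus, so its integral over
every measurable part of `s` is zero. The density is thus obtained without summing `w₁` over fibres.
-/
theorem ae_restrict_eq_zero_of_coeff_eq (hp₁ : Measurable p₁) (hw₁ : Integrable w₁ μ₁)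
    {D : Lp ℂ 2 (volume : Measure (UnitAddTorus (Fin d)))}
    (hD : ∀ k, UnitAddTorus.mFourierCoeff D k =
      ∫ x, UnitAddTorus.mFourier (-k) (p₁ x) * w₁ x ∂μ₁)
    {s : Set (UnitAddTorus (Fin d))} (hs : MeasurableSet s)
    (h0 : ∀ᵐ x ∂μ₁, p₁ x ∈ s → w₁ x = 0) :
    ∀ᵐ t ∂(volume : Measure (UnitAddTorus (Fin d))), t ∈ s → D t = 0 := by
  have hDi : Integrable D (volume : Measure (UnitAddTorus (Fin d))) :=
    (Lp.memLp D).integrable (by norm_num)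
  have key : ∀ t : Set (UnitAddTorus (Fin d)), MeasurableSet t →
      ∫ x in t, D x = ∫ x in p₁ ⁻¹' t, w₁ x ∂μ₁ := fun t ht =>
    setIntegral_preimage_eq_of_coeff_eq (p₁ := id) measurable_id hp₁ hDi hw₁
      (fun k => by simpa [UnitAddTorus.mFourierCoeff] using hD k) ht
  have hz : ∀ t : Set (UnitAddTorus (Fin d)), MeasurableSet t →
      ∫ x in t, s.indicator D x = 0 := by
    intro t ht
    rw [setIntegral_indicator hs, key _ (ht.inter hs)]
    refine setIntegral_eq_zero_of_ae_eq_zero ?_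
    filter_upwards [h0] with x hx hxt using hx hxt.2
  have := (hDi.indicator hs).ae_eq_zero_of_forall_setIntegral_eq_zero fun t ht _ => hz t ht
  filter_upwards [this] with x hx hxs
  simpa [Set.indicator_of_mem hxs] using hx

/-- Square-summable families of Fourier coefficients of functions living over complementary parts
of the torus are orthogonal. -/
theorem tsum_conj_mul_coeff_eq_zero (hp₁ : Measurable p₁) (hp₂ : Measurable p₂)
    (hw₁ : Integrable w₁ μ₁) (hw₂ : Integrable w₂ μ₂) {c₁ c₂ : (Fin d → ℤ) → ℂ}
    (hs₁ : Summable fun k => ‖c₁ k‖ ^ 2) (hs₂ : Summable fun k => ‖c₂ k‖ ^ 2)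
    (hc₁ : ∀ k, c₁ k = ∫ x, UnitAddTorus.mFourier (-k) (p₁ x) * w₁ x ∂μ₁)
    (hc₂ : ∀ k, c₂ k = ∫ x, UnitAddTorus.mFourier (-k) (p₂ x) * w₂ x ∂μ₂)
    {s : Set (UnitAddTorus (Fin d))} (hs : MeasurableSet s)
    (h₁ : ∀ᵐ x ∂μ₁, p₁ x ∈ s → w₁ x = 0) (h₂ : ∀ᵐ x ∂μ₂, p₂ x ∉ s → w₂ x = 0) :
    ∑' k, conj (c₁ k) * c₂ k = 0 := by
  obtain ⟨D₁, hD₁⟩ := exists_lp_mFourierCoeff_eq hs₁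
  obtain ⟨D₂, hD₂⟩ := exists_lp_mFourierCoeff_eq hs₂
  have e₁ := ae_restrict_eq_zero_of_coeff_eq hp₁ hw₁ (fun k => (hD₁ k).trans (hc₁ k)) hs h₁
  have e₂ := ae_restrict_eq_zero_of_coeff_eq hp₂ hw₂ (fun k => (hD₂ k).trans (hc₂ k)) hs.compl h₂
  have := (UnitAddTorus.hasSum_prod_mFourierCoeff D₁ D₂).tsum_eq
  simp only [hD₁, hD₂] at this
  rw [this]
  refine integral_eq_zero_of_ae ?_
  filter_upwards [e₁, e₂] with t h1 h2
  by_cases ht : t ∈ s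
  · simp [h1 ht]
  · simp [h2 ht]

end Uniqueness

end Torus

end WeylHeisenberg

end

noncomputable section

namespace WeylHeisenberg

/-! ### The Fourier transform of translates and modulates -/

section FourierTransform

variable {d : ℕ}

theorem coeFn_transl (a : EuclideanSpace ℝ (Fin d)) (f : L2 d) :
    transl a f =ᵐ[volume] fun x => f (x - a) :=
  Lp.coeFn_compMeasurePreserving f (measurePreserving_sub_right volume a)

theorem coeFn_modulate (a : EuclideanSpace ℝ (Fin d)) (f : L2 d) :
    modulate a f =ᵐ[volume] modulateFun a f :=
  MemLp.coeFn_toLp _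

theorem continuous_transl (a : EuclideanSpace ℝ (Fin d)) : Continuous (transl a) :=
  (Lp.isometry_compMeasurePreserving (measurePreserving_sub_right volume a)).continuous

theorem norm_modulateFun (a : EuclideanSpace ℝ (Fin d)) (f : EuclideanSpace ℝ (Fin d) → ℂ)
    (x : EuclideanSpace ℝ (Fin d)) : ‖modulateFun a f x‖ = ‖f x‖ := by
  have h1 : (2 * Real.pi * Complex.I * ((inner ℝ a x : ℝ) : ℂ))
      = ((2 * Real.pi * inner ℝ a x : ℝ) : ℂ) * Complex.I := by
    push_cast; ring
  rw [modulateFun, norm_mul, h1, Complex.norm_exp_ofReal_mul_I, one_mul]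

theorem isometry_modulate (a : EuclideanSpace ℝ (Fin d)) : Isometry (modulate a) := by
  refine Isometry.of_dist_eq fun f g => ?_
  rw [dist_eq_norm, dist_eq_norm, Lp.norm_def, Lp.norm_def]
  congr 1
  refine eLpNorm_congr_norm_ae ?_
  filter_upwards [Lp.coeFn_sub (modulate a f) (modulate a g), Lp.coeFn_sub f g,
    coeFn_modulate a f, coeFn_modulate a g] with x h1 h2 h3 h4
  rw [h1, h2, Pi.sub_apply, Pi.sub_apply, h3, h4]
  refine Eq.trans ?_ (norm_modulateFun a (fun y => f y - g y) x)
  simp only [modulateFun, mul_sub]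

theorem fourier_comp_sub (a : EuclideanSpace ℝ (Fin d)) (f : EuclideanSpace ℝ (Fin d) → ℂ) :
    𝓕 (fun x => f (x - a)) = modulateFun (-a) (𝓕 f) := by
  ext w
  rw [Real.fourier_eq', modulateFun, Real.fourier_eq',
    ← integral_add_right_eq_self _ a, ← integral_const_mul]
  refine integral_congr_ae (Eventually.of_forall fun x => ?_)
  simp only [smul_eq_mul, add_sub_cancel_right]
  rw [← mul_assoc, ← Complex.exp_add]
  congr 2
  simp only [inner_add_left, inner_neg_left]
  push_cast
  ring

theorem fourierInv_comp_sub (a : EuclideanSpace ℝ (Fin d)) (f : EuclideanSpace ℝ (Fin d) → ℂ) :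
    𝓕⁻ (fun x => f (x - a)) = modulateFun a (𝓕⁻ f) := by
  ext w
  rw [Real.fourierInv_eq', modulateFun, Real.fourierInv_eq',
    ← integral_add_right_eq_self _ a, ← integral_const_mul]
  refine integral_congr_ae (Eventually.of_forall fun x => ?_)
  simp only [smul_eq_mul, add_sub_cancel_right]
  rw [← mul_assoc, ← Complex.exp_add]
  congr 2
  simp only [inner_add_left]
  push_cast
  ring

open SchwartzMap in
theorem transl_toLp (a : EuclideanSpace ℝ (Fin d)) (f : 𝓢(EuclideanSpace ℝ (Fin d), ℂ)) :
    transl a (f.toLp 2) = (f.compSubConstCLM ℂ a).toLp 2 := by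
  refine Lp.ext ?_
  have h := (measurePreserving_sub_right (volume : Measure (EuclideanSpace ℝ (Fin d)))
    a).quasiMeasurePreserving.ae_eq_comp (f.coeFn_toLp 2)
  filter_upwards [coeFn_transl a (f.toLp 2), (f.compSubConstCLM ℂ a).coeFn_toLp 2, h]
    with x h1 h2 h3
  rw [h1, h2]
  exact h3

theorem modulate_congr {a : EuclideanSpace ℝ (Fin d)} {f g : L2 d}
    {u : EuclideanSpace ℝ (Fin d) → ℂ} (hf : f =ᵐ[volume] u)
    (hg : g =ᵐ[volume] modulateFun a u) : g = modulate a f := by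
  refine Lp.ext ?_
  filter_upwards [hf, hg, coeFn_modulate a f] with x h1 h2 h3
  rw [h2, h3, modulateFun, modulateFun, h1]

open SchwartzMap in
-- Both sides are continuous in `f`, so it suffices to treat Schwartz functions, where the transform
-- is an integral.
theorem fourier_transl (a : EuclideanSpace ℝ (Fin d)) (f : L2 d) :
    𝓕 (transl a f) = modulate (-a) (𝓕 f) := by
  refine DenseRange.induction_on (p := fun f : L2 d => 𝓕 (transl a f) = modulate (-a) (𝓕 f))
    (SchwartzMap.denseRange_toLpCLM (E := EuclideanSpace ℝ (Fin d)) (F := ℂ) (p := 2)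
      ENNReal.ofNat_ne_top) f ?_ ?_
  · exact isClosed_eq ((Lp.fourierTransformₗᵢ _ ℂ).continuous.comp (continuous_transl a))
      ((isometry_modulate (-a)).continuous.comp (Lp.fourierTransformₗᵢ _ ℂ).continuous)
  · intro φ
    change 𝓕 (transl a (φ.toLp 2)) = modulate (-a) (𝓕 (φ.toLp 2))
    rw [transl_toLp, SchwartzMap.toLp_fourier_eq, SchwartzMap.toLp_fourier_eq]
    have h1 := (𝓕 φ).coeFn_toLp 2 volume
    have h2 := (𝓕 (φ.compSubConstCLM ℂ a)).coeFn_toLp 2 volume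
    rw [SchwartzMap.fourier_coe] at h1 h2
    have h3 := fourier_comp_sub a φ
    refine modulate_congr h1 ?_
    rw [← h3]
    exact h2

open SchwartzMap in
theorem fourierInv_transl (a : EuclideanSpace ℝ (Fin d)) (f : L2 d) :
    𝓕⁻ (transl a f) = modulate a (𝓕⁻ f) := by
  refine DenseRange.induction_on (p := fun f : L2 d => 𝓕⁻ (transl a f) = modulate a (𝓕⁻ f))
    (SchwartzMap.denseRange_toLpCLM (E := EuclideanSpace ℝ (Fin d)) (F := ℂ) (p := 2)
      ENNReal.ofNat_ne_top) f ?_ ?_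
  · exact isClosed_eq ((Lp.fourierTransformₗᵢ _ ℂ).symm.continuous.comp (continuous_transl a))
      ((isometry_modulate a).continuous.comp (Lp.fourierTransformₗᵢ _ ℂ).symm.continuous)
  · intro φ
    change 𝓕⁻ (transl a (φ.toLp 2)) = modulate a (𝓕⁻ (φ.toLp 2))
    rw [transl_toLp, SchwartzMap.toLp_fourierInv_eq, SchwartzMap.toLp_fourierInv_eq]
    have h1 := (𝓕⁻ φ).coeFn_toLp 2 volume
    have h2 := (𝓕⁻ (φ.compSubConstCLM ℂ a)).coeFn_toLp 2 volume
    rw [SchwartzMap.fourierInv_coe] at h1 h2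
    have h3 := fourierInv_comp_sub a φ
    refine modulate_congr h1 ?_
    rw [← h3]
    exact h2

theorem fourier_modulate (a : EuclideanSpace ℝ (Fin d)) (f : L2 d) :
    𝓕 (modulate a f) = transl a (𝓕 f) := by
  have h := fourierInv_transl a (𝓕 f)
  rw [FourierTransform.fourierInv_fourier_eq] at h
  rw [← h, FourierTransform.fourier_fourierInv_eq]

end FourierTransform

end WeylHeisenberg

end

noncomputable section

namespace WeylHeisenberg

/-! ### Supports of periodizations -/

section PeriodSupport

variable {d : ℕ}

/-- The linear map `v ↦ M v`. -/
def mulVₗ (M : Matrix (Fin d) (Fin d) ℝ) :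
    EuclideanSpace ℝ (Fin d) →ₗ[ℝ] EuclideanSpace ℝ (Fin d) where
  toFun := mulV M
  map_add' v w := by simp [mulV, Matrix.mulVec_add]
  map_smul' c v := by simp [mulV, Matrix.mulVec_smul]

theorem mulV_zero (M : Matrix (Fin d) (Fin d) ℝ) : mulV M 0 = 0 := map_zero (mulVₗ M)

theorem mulV_mulV (M N : Matrix (Fin d) (Fin d) ℝ) (v : EuclideanSpace ℝ (Fin d)) :
    mulV M (mulV N v) = mulV (M * N) v := by
  simp [mulV, Matrix.mulVec_mulVec]

theorem mulV_one (v : EuclideanSpace ℝ (Fin d)) : mulV 1 v = v := by simp [mulV]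

theorem intV_zero : intV (0 : Fin d → ℤ) = 0 := by ext i; simp [intV]

theorem intV_add (k l : Fin d → ℤ) : intV (k + l) = intV k + intV l := by ext i; simp [intV]

theorem intV_neg (k : Fin d → ℤ) : intV (-k) = -intV k := by ext i; simp [intV]

theorem inner_mulV (M : Matrix (Fin d) (Fin d) ℝ) (v w : EuclideanSpace ℝ (Fin d)) :
    (inner ℝ (mulV M v) w : ℝ) = inner ℝ v (mulV Mᵀ w) := by
  simp only [mulV, EuclideanSpace.inner_eq_star_dotProduct, star_trivial]
  rw [Matrix.dotProduct_mulVec, Matrix.mulVec_transpose, dotProduct_comm]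

theorem measurable_mulV (M : Matrix (Fin d) (Fin d) ℝ) : Measurable (mulV M) :=
  (mulVₗ M).continuous_of_finiteDimensional.measurable

theorem mulV_injective {M : Matrix (Fin d) (Fin d) ℝ} (hM : IsUnit M.det) :
    Function.Injective (mulV M) := fun v w h => by
  have := congrArg (mulV M⁻¹) h
  rwa [mulV_mulV, mulV_mulV, Matrix.nonsing_inv_mul _ hM, mulV_one, mulV_one] at this

theorem quasiMeasurePreserving_mulV {M : Matrix (Fin d) (Fin d) ℝ} (hM : IsUnit M.det) :
    Measure.QuasiMeasurePreserving (mulV M) volume volume :=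
  Measure.LinearMap.quasiMeasurePreserving volume (mulVₗ M)
    (LinearEquiv.isUnit_det' (LinearEquiv.ofInjectiveEndo (mulVₗ M) (mulV_injective hM))).ne_zero

theorem measurable_coeFn_L2 (φ : L2 d) : Measurable φ := (Lp.stronglyMeasurable φ).measurable

theorem measurable_periodization (M : Matrix (Fin d) (Fin d) ℝ) (φ : L2 d) :
    Measurable (periodization M φ) :=
  Measurable.tsum fun k => ((measurable_coeFn_L2 φ).comp
    ((measurable_mulV _).comp (measurable_id.add_const (intV k)))).enorm.pow_const 2

theorem measurableSet_periodSupport (M : Matrix (Fin d) (Fin d) ℝ) (φ : L2 d) :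
    MeasurableSet (periodSupport M φ) :=
  measurableSet_support (measurable_periodization M φ)

theorem periodization_add_intV (M : Matrix (Fin d) (Fin d) ℝ) (φ : L2 d) (k : Fin d → ℤ)
    (ξ : EuclideanSpace ℝ (Fin d)) : periodization M φ (ξ + intV k) = periodization M φ ξ := by
  refine Eq.trans ?_ ((Equiv.addLeft k).tsum_eq fun l => ‖φ (mulV (Mᵀ)⁻¹ (ξ + intV l))‖ₑ ^ 2)
  simp only [periodization, Equiv.coe_addLeft, intV_add, add_assoc]

theorem add_intV_mem_periodSupport (M : Matrix (Fin d) (Fin d) ℝ) (φ : L2 d) (k : Fin d → ℤ)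
    (ξ : EuclideanSpace ℝ (Fin d)) : ξ + intV k ∈ periodSupport M φ ↔ ξ ∈ periodSupport M φ := by
  simp only [periodSupport, Function.mem_support, periodization_add_intV]

/-- `‖φ x‖ₑ ^ 2` is the term `k = 0` of the periodization at `Mᵀ x`. -/
theorem eq_zero_of_notMem_periodSupport {M : Matrix (Fin d) (Fin d) ℝ} (hM : IsUnit M.det)
    {φ : L2 d} {x : EuclideanSpace ℝ (Fin d)} (hx : mulV Mᵀ x ∉ periodSupport M φ) :
    φ x = 0 := by
  rw [periodSupport, Function.notMem_support, periodization, ENNReal.tsum_eq_zero] at hx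
  have h := hx 0
  rw [intV_zero, add_zero, mulV_mulV, Matrix.nonsing_inv_mul _ (by rwa [Matrix.det_transpose]),
    mulV_one] at h
  simpa using h

theorem isUnit_det_transpose_inv {M : Matrix (Fin d) (Fin d) ℝ} (hM : IsUnit M.det) :
    IsUnit (Mᵀ)⁻¹.det :=
  Matrix.isUnit_nonsing_inv_det _ (by rwa [Matrix.det_transpose])

/-- If `φ` vanishes over a `ℤᵈ`-invariant set, then so does its periodization. -/
theorem volume_periodSupport_inter_eq_zero {M : Matrix (Fin d) (Fin d) ℝ} (hM : IsUnit M.det)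
    {φ : L2 d} {s : Set (EuclideanSpace ℝ (Fin d))}
    (hper : ∀ (k : Fin d → ℤ) (v), v + intV k ∈ s ↔ v ∈ s)
    (h : ∀ᵐ x, mulV Mᵀ x ∈ s → φ x = 0) :
    volume (periodSupport M φ ∩ s) = 0 := by
  -- Each map `ξ ↦ (Mᵀ)⁻¹ (ξ + k)` pulls null sets back to null sets, and there are only countably
  -- many `k`.
  have h1 : ∀ k : Fin d → ℤ, ∀ᵐ ξ : EuclideanSpace ℝ (Fin d),
      mulV Mᵀ (mulV (Mᵀ)⁻¹ (ξ + intV k)) ∈ s → φ (mulV (Mᵀ)⁻¹ (ξ + intV k)) = 0 := fun k =>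
    ((quasiMeasurePreserving_mulV (isUnit_det_transpose_inv hM)).comp
      (measurePreserving_add_right volume (intV k)).quasiMeasurePreserving).ae h
  have h2 : ∀ᵐ ξ : EuclideanSpace ℝ (Fin d), ξ ∉ periodSupport M φ ∩ s := by
    filter_upwards [ae_all_iff.2 h1] with ξ hξ hmem
    refine hmem.1 (ENNReal.tsum_eq_zero.2 fun k => ?_)
    have h3 := hξ k
    rw [mulV_mulV, Matrix.mul_nonsing_inv _ (by rwa [Matrix.det_transpose]), mulV_one, hper] at h3
    simp [h3 hmem.2]
  simpa [ae_iff] using h2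

theorem measurable_toTorus_mulV (M : Matrix (Fin d) (Fin d) ℝ) (a : EuclideanSpace ℝ (Fin d)) :
    Measurable fun x => toTorus (mulV Mᵀ (x - a)) :=
  measurable_toTorus.comp ((measurable_mulV _).comp (measurable_id.sub_const a))

variable {M N : Matrix (Fin d) (Fin d) ℝ} {φ ψ : L2 d} {w₁ w₂ : EuclideanSpace ℝ (Fin d) → ℂ}

/-- The images of `|φ|²` and `w₂` on the torus agree. Over the difference of the supports `w₂`
vanishes, so the integral of `|φ|²` there is zero; positivity then gives `φ = 0` almost everywhere
over that set. -/
theorem volume_periodSupport_diff_eq_zero (hM : IsUnit M.det) (hN : IsUnit N.det)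
    (hw₂ : Integrable w₂) (h₂ : ∀ x, ψ x = 0 → w₂ x = 0)
    (h : ∀ k : Fin d → ℤ,
      ∫ x, UnitAddTorus.mFourier (-k) (toTorus (mulV Mᵀ x)) * (conj (φ x) * φ x) =
        ∫ x, UnitAddTorus.mFourier (-k) (toTorus (mulV Nᵀ x)) * w₂ x) :
    volume (periodSupport M φ \ periodSupport N ψ) = 0 := by
  have hper : ∀ (k : Fin d → ℤ) (v), v + intV k ∈ periodSupport M φ \ periodSupport N ψ ↔
      v ∈ periodSupport M φ \ periodSupport N ψ := fun k v => by
    simp only [Set.mem_sdiff, add_intV_mem_periodSupport]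
  obtain ⟨t, ht, hts⟩ := exists_toTorus_preimage_eq
    ((measurableSet_periodSupport M φ).diff (measurableSet_periodSupport N ψ)) hper
  have hmem : ∀ v, toTorus v ∈ t ↔ v ∈ periodSupport M φ \ periodSupport N ψ := fun v => by
    rw [← hts]; rfl
  have hp : ∀ K : Matrix (Fin d) (Fin d) ℝ, Measurable fun x => toTorus (mulV Kᵀ x) := fun K =>
    measurable_toTorus.comp (measurable_mulV _)
  have hw₁ : Integrable fun x => conj (φ x) * φ x := by
    simpa only [RCLike.inner_apply'] using L2.integrable_inner (𝕜 := ℂ) φ φ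
  have key := setIntegral_preimage_eq_of_coeff_eq (hp M) (hp N) hw₁ hw₂ h ht
  have hzero : ∫ x in (fun x => toTorus (mulV Nᵀ x)) ⁻¹' t, w₂ x = 0 := by
    refine setIntegral_eq_zero_of_forall_eq_zero fun x hx => h₂ x ?_
    exact eq_zero_of_notMem_periodSupport hN ((hmem _).1 hx).2
  have hsq : ∀ x, conj (φ x) * φ x = ((‖φ x‖ ^ 2 : ℝ) : ℂ) := fun x => by
    rw [mul_comm, Complex.mul_conj, Complex.normSq_eq_norm_sq]
  rw [hzero] at key
  simp only [hsq] at key hw₁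
  have hsqi : Integrable fun x => ‖φ x‖ ^ 2 := hw₁.re
  rw [integral_complex_ofReal, Complex.ofReal_eq_zero,
    setIntegral_eq_zero_iff_of_nonneg_ae (Eventually.of_forall fun x => by positivity)
      hsqi.integrableOn] at key
  have key' := (ae_restrict_iff' (hp M ht)).1 key
  have := volume_periodSupport_inter_eq_zero (φ := φ) hM hper (by
    filter_upwards [key'] with x hx hxs
    simpa using hx ((hmem _).2 hxs))
  rwa [Set.inter_eq_right.2 Set.sdiff_subset] at this

theorem tsum_conj_mul_eq_zero_of_periodSupport (hM : IsUnit M.det) (hN : IsUnit N.det)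
    (hdisj : volume (periodSupport M φ ∩ periodSupport N ψ) = 0)
    {a b : EuclideanSpace ℝ (Fin d)} (hw₁ : Integrable w₁) (hw₂ : Integrable w₂)
    (h₁ : ∀ x, φ (x - a) = 0 → w₁ x = 0) (h₂ : ∀ x, ψ (x - b) = 0 → w₂ x = 0)
    {c₁ c₂ : (Fin d → ℤ) → ℂ}
    (hs₁ : Summable fun k => ‖c₁ k‖ ^ 2) (hs₂ : Summable fun k => ‖c₂ k‖ ^ 2)
    (hc₁ : ∀ k, c₁ k = ∫ x, UnitAddTorus.mFourier (-k) (toTorus (mulV Mᵀ (x - a))) * w₁ x)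
    (hc₂ : ∀ k, c₂ k = ∫ x, UnitAddTorus.mFourier (-k) (toTorus (mulV Nᵀ (x - b))) * w₂ x) :
    ∑' k, conj (c₁ k) * c₂ k = 0 := by
  -- The support of the periodization of `ψ` separates the two weights: `w₂` vanishes off it, and
  -- `w₁` vanishes almost everywhere over it by disjointness.
  obtain ⟨t, ht, hts⟩ := exists_toTorus_preimage_eq
    (measurableSet_periodSupport N ψ) (add_intV_mem_periodSupport N ψ)
  have hmem : ∀ v, toTorus v ∈ t ↔ v ∈ periodSupport N ψ := fun v => by
    rw [← hts]; rfl
  refine tsum_conj_mul_coeff_eq_zero (measurable_toTorus_mulV M a) (measurable_toTorus_mulV N b)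
    hw₁ hw₂ hs₁ hs₂ hc₁ hc₂ ht ?_ (Eventually.of_forall fun x hx => h₂ x ?_)
  · have h0 : ∀ᵐ ξ : EuclideanSpace ℝ (Fin d), ξ ∉ periodSupport M φ ∩ periodSupport N ψ := by
      simpa [ae_iff] using hdisj
    have h3 := ((quasiMeasurePreserving_mulV (M := Mᵀ) (by rwa [Matrix.det_transpose])).comp
      (measurePreserving_sub_right volume a).quasiMeasurePreserving).ae h0
    filter_upwards [h3] with x hx hxt
    exact h₁ x (eq_zero_of_notMem_periodSupport hM fun hx' => hx ⟨hx', (hmem _).1 hxt⟩)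
  · exact eq_zero_of_notMem_periodSupport hN fun hx' => hx ((hmem _).2 hx')

end PeriodSupport

/-! ### Frame coefficients of Weyl-Heisenberg systems -/

section Coefficients

variable {d : ℕ}

/-- The phase comes from splitting `⟨Al, x⟩ = ⟨Al, b⟩ + ⟨l, Aᵀ(x - b)⟩`. Centring at `b` puts the
weight over the support attached to `f` itself. -/
theorem inner_modulate_transl (A : Matrix (Fin d) (Fin d) ℝ) (l : Fin d → ℤ)
    (b : EuclideanSpace ℝ (Fin d)) (f h : L2 d) :
    inner ℂ (modulate (mulV A (intV l)) (transl b f)) h =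
      Complex.exp (-(2 * Real.pi * Complex.I * ((inner ℝ (mulV A (intV l)) b : ℝ) : ℂ))) *
        ∫ x, UnitAddTorus.mFourier (-l) (toTorus (mulV Aᵀ (x - b))) * (conj (f (x - b)) * h x) := by
  rw [L2.inner_def, ← integral_const_mul]
  refine integral_congr_ae ?_
  filter_upwards [coeFn_modulate (mulV A (intV l)) (transl b f), coeFn_transl b f] with x h1 h2
  rw [RCLike.inner_apply', h1, modulateFun, h2, mFourier_toTorus, map_mul, ← Complex.exp_conj,
    ← mul_assoc (Complex.exp _) (Complex.exp _), ← Complex.exp_add, mul_assoc]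
  congr 2
  rw [intV_neg, inner_neg_left, ← inner_mulV, inner_sub_right]
  simp only [map_mul, Complex.conj_I, Complex.conj_ofReal, map_ofNat]
  push_cast
  ring

/-- On the Fourier side the modulation acts last, as a translation by `a`; the character is
therefore already centred at `a` and no phase is left. -/
theorem inner_modulate_transl_mulV (X : Matrix (Fin d) (Fin d) ℝ) (z : Fin d → ℤ)
    (a : EuclideanSpace ℝ (Fin d)) (f h : L2 d) :
    inner ℂ h (modulate a (transl (mulV X (intV z)) f)) =
      ∫ x, UnitAddTorus.mFourier (-z) (toTorus (mulV Xᵀ (x - a))) *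
        (conj (𝓕 h x) * 𝓕 f (x - a)) := by
  rw [← Lp.inner_fourier_eq, fourier_modulate, fourier_transl, L2.inner_def]
  refine integral_congr_ae ?_
  have h3 := (measurePreserving_sub_right (volume : Measure (EuclideanSpace ℝ (Fin d)))
    a).quasiMeasurePreserving.ae_eq_comp (coeFn_modulate (-mulV X (intV z)) (𝓕 f))
  filter_upwards [coeFn_transl a (modulate (-mulV X (intV z)) (𝓕 f)), h3] with x h1 h2
  rw [Function.comp_apply, Function.comp_apply] at h2
  rw [RCLike.inner_apply', h1, h2, modulateFun, mFourier_toTorus, intV_neg, inner_neg_left,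
    inner_neg_left, ← inner_mulV]
  ring

theorem integrable_conj_mul_comp_sub (u v : L2 d) (a : EuclideanSpace ℝ (Fin d)) :
    Integrable fun x => conj (u x) * v (x - a) := by
  refine (L2.integrable_inner (𝕜 := ℂ) u (transl a v)).congr ?_
  filter_upwards [coeFn_transl a v] with x hx
  rw [RCLike.inner_apply', hx]

theorem integrable_conj_comp_sub_mul (u v : L2 d) (a : EuclideanSpace ℝ (Fin d)) :
    Integrable fun x => conj (u (x - a)) * v x := by
  refine (L2.integrable_inner (𝕜 := ℂ) (transl a u) v).congr ?_
  filter_upwards [coeFn_transl a u] with x hx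
  rw [RCLike.inner_apply', hx]

variable {n : ℕ} {A X B Y : Matrix (Fin d) (Fin d) ℝ} {f g : Fin n → L2 d}

theorem analysis_apply {H ι : Type*} [NormedAddCommGroup H] [InnerProductSpace ℂ H] {x : ι → H}
    (hx : IsFrame x) (h : H) (i : ι) : analysis x hx h i = inner ℂ (x i) h := rfl

theorem volume_periodSupport_diff_of_range_le (hA : IsUnit A.det) (hX : IsUnit X.det)
    (hB : IsUnit B.det) (hY : IsUnit Y.det)
    (hF : IsFrame (whSystem A X f)) (hG : IsFrame (whSystem B Y g))
    (hle : LinearMap.range (analysis _ hF) ≤ LinearMap.range (analysis _ hG)) (j : Fin n) :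
    volume (periodSupport X (𝓕 (f j)) \ periodSupport Y (𝓕 (g j))) = 0 ∧
      volume (periodSupport A (f j) \ periodSupport B (g j)) = 0 := by
  -- Testing the inclusion on `f j` itself makes the weight of the first family `|f j|²`, or `|𝓕 (f
  -- j)|²` on the Fourier side.
  obtain ⟨h, hh⟩ := hle ⟨f j, rfl⟩
  have hi : ∀ p, inner ℂ (whSystem B Y g p) h = inner ℂ (whSystem A X f p) (f j) := fun p => by
    rw [← analysis_apply hG, hh, analysis_apply]
  constructor
  · refine volume_periodSupport_diff_eq_zero hX hY
      (by simpa using integrable_conj_mul_comp_sub (𝓕 h) (𝓕 (g j)) 0)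
      (fun x hx => by simp [hx]) fun z => ?_
    have h1 := congrArg conj (hi (j, 0, z))
    simp only [inner_conj_symm, whSystem, inner_modulate_transl_mulV, intV_zero, mulV_zero,
      sub_zero] at h1
    exact h1.symm
  · refine volume_periodSupport_diff_eq_zero hA hB
      (by simpa using integrable_conj_comp_sub_mul (g j) h 0)
      (fun x hx => by simp [hx]) fun l => ?_
    have h1 := hi (j, l, 0)
    simp only [whSystem, inner_modulate_transl, intV_zero, mulV_zero, sub_zero, inner_zero_right,
      Complex.ofReal_zero, mul_zero, neg_zero, Complex.exp_zero, one_mul] at h1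
    exact h1.symm

/-! ### Computing the inner product in `ℓ²` slice by slice -/

section Slices

variable {H α β γ : Type*} [NormedAddCommGroup H] [InnerProductSpace ℂ H] {x y : α × β × γ → H}

theorem IsFrame.summable_norm_inner_sq {ι : Type*} {x : ι → H} (hx : IsFrame x) (h : H) :
    Summable fun i => ‖inner ℂ (x i) h‖ ^ 2 := by
  obtain ⟨_, _, -, hC⟩ := hx
  exact (hC h).1

theorem hasSum_inner_analysis {ι : Type*} {x y : ι → H} (hx : IsFrame x) (hy : IsFrame y)
    (h h' : H) : HasSum (fun i => conj (inner ℂ (x i) h) * inner ℂ (y i) h')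
      (inner ℂ (analysis x hx h) (analysis y hy h')) := by
  refine (lp.hasSum_inner (𝕜 := ℂ) (analysis x hx h) (analysis y hy h')).congr_fun fun i => ?_
  exact (RCLike.inner_apply' _ _).symm

theorem inner_analysis_eq_zero_of_right_slices (hx : IsFrame x) (hy : IsFrame y) {h h' : H}
    (hz : ∀ a b, ∑' c, conj (inner ℂ (x (a, b, c)) h) * inner ℂ (y (a, b, c)) h' = 0) :
    inner ℂ (analysis x hx h) (analysis y hy h') = 0 := by
  have hs := hasSum_inner_analysis hx hy h h'
  rw [← hs.tsum_eq, hs.summable.tsum_prod]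
  refine (tsum_congr fun a => ?_).trans tsum_zero
  rw [(hs.summable.prod_factor a).tsum_prod]
  exact (tsum_congr fun b => hz a b).trans tsum_zero

theorem inner_analysis_eq_zero_of_middle_slices (hx : IsFrame x) (hy : IsFrame y) {h h' : H}
    (hz : ∀ a c, ∑' b, conj (inner ℂ (x (a, b, c)) h) * inner ℂ (y (a, b, c)) h' = 0) :
    inner ℂ (analysis x hx h) (analysis y hy h') = 0 := by
  have hs := hasSum_inner_analysis hx hy h h'
  rw [← hs.tsum_eq, hs.summable.tsum_prod]
  refine (tsum_congr fun a => ?_).trans tsum_zero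
  have hs' := (Equiv.prodComm γ β).summable_iff.2 (hs.summable.prod_factor a)
  rw [← (Equiv.prodComm γ β).tsum_eq]
  refine hs'.tsum_prod.trans ?_
  exact (tsum_congr fun c => hz a c).trans tsum_zero

end Slices

/-! ### Orthogonality of the ranges -/

theorem range_analysis_isOrtho_of_fourier (hX : IsUnit X.det) (hY : IsUnit Y.det)
    (hF : IsFrame (whSystem A X f)) (hG : IsFrame (whSystem B Y g))
    (hdisj : ∀ j, volume (periodSupport X (𝓕 (f j)) ∩ periodSupport Y (𝓕 (g j))) = 0) :
    LinearMap.range (analysis _ hF) ⟂ LinearMap.range (analysis _ hG) := by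
  rw [Submodule.isOrtho_iff_inner_eq]
  rintro _ ⟨h, rfl⟩ _ ⟨h', rfl⟩
  refine inner_analysis_eq_zero_of_right_slices hF hG fun j l => ?_
  have hinj : Function.Injective fun z : Fin d → ℤ => (j, l, z) := fun z z' hz => by
    simpa using hz
  have key := tsum_conj_mul_eq_zero_of_periodSupport hX hY (hdisj j)
    (integrable_conj_mul_comp_sub (𝓕 h) (𝓕 (f j)) (mulV A (intV l)))
    (integrable_conj_mul_comp_sub (𝓕 h') (𝓕 (g j)) (mulV B (intV l)))
    (a := mulV A (intV l)) (b := mulV B (intV l))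
    (fun x hx => by simp [hx]) (fun x hx => by simp [hx])
    (c₁ := fun z => conj (inner ℂ (whSystem A X f (j, l, z)) h))
    (c₂ := fun z => conj (inner ℂ (whSystem B Y g (j, l, z)) h'))
    (by simpa only [RCLike.norm_conj, Function.comp_def] using
      (hF.summable_norm_inner_sq h).comp_injective hinj)
    (by simpa only [RCLike.norm_conj, Function.comp_def] using
      (hG.summable_norm_inner_sq h').comp_injective hinj)
    (fun z => by
      rw [inner_conj_symm]; exact inner_modulate_transl_mulV _ _ _ _ _)
    (fun z => by
      rw [inner_conj_symm]; exact inner_modulate_transl_mulV _ _ _ _ _)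
  -- `key` concerns the conjugated coefficients, so the required sum is its conjugate.
  have := congrArg conj key
  rw [Complex.conj_tsum, map_zero] at this
  simpa only [map_mul, RingHomCompTriple.comp_apply, RingHom.id_apply] using this

theorem range_analysis_isOrtho_of_time (hA : IsUnit A.det) (hB : IsUnit B.det)
    (hXY : Xᵀ * A = Yᵀ * B)
    (hF : IsFrame (whSystem A X f)) (hG : IsFrame (whSystem B Y g))
    (hdisj : ∀ j, volume (periodSupport A (f j) ∩ periodSupport B (g j)) = 0) :
    LinearMap.range (analysis _ hF) ⟂ LinearMap.range (analysis _ hG) := by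
  rw [Submodule.isOrtho_iff_inner_eq]
  rintro _ ⟨h, rfl⟩ _ ⟨h', rfl⟩
  refine inner_analysis_eq_zero_of_middle_slices hF hG fun j z => ?_
  have hinj : Function.Injective fun l : Fin d → ℤ => (j, l, z) := fun l l' hl => by
    simpa using hl
  -- The factor `e^{iθ}` undoes the phase in `inner_modulate_transl`. By `hθ` one `θ` serves both
  -- families, so the unimodular factors cancel in each product `conj (c₁ l) * c₂ l`.
  let θ : (Fin d → ℤ) → ℝ := fun l => 2 * Real.pi * inner ℝ (mulV A (intV l)) (mulV X (intV z))
  have hθ : ∀ l, (inner ℝ (mulV B (intV l)) (mulV Y (intV z)) : ℝ) =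
      inner ℝ (mulV A (intV l)) (mulV X (intV z)) := fun l => by
    have := congrArg Matrix.transpose hXY
    rw [Matrix.transpose_mul, Matrix.transpose_mul, Matrix.transpose_transpose,
      Matrix.transpose_transpose] at this
    rw [inner_mulV, inner_mulV, mulV_mulV, mulV_mulV, this]
  have hexp : ∀ l, Complex.exp (θ l * Complex.I) *
      Complex.exp (-(2 * Real.pi * Complex.I *
        ((inner ℝ (mulV A (intV l)) (mulV X (intV z)) : ℝ) : ℂ))) = 1 := fun l => by
    rw [← Complex.exp_add, ← Complex.exp_zero]
    congr 1
    simp only [θ]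
    push_cast
    ring
  have key := tsum_conj_mul_eq_zero_of_periodSupport hA hB (hdisj j)
    (integrable_conj_comp_sub_mul (f j) h (mulV X (intV z)))
    (integrable_conj_comp_sub_mul (g j) h' (mulV Y (intV z)))
    (a := mulV X (intV z)) (b := mulV Y (intV z))
    (fun x hx => by simp [hx]) (fun x hx => by simp [hx])
    (c₁ := fun l => Complex.exp (θ l * Complex.I) * inner ℂ (whSystem A X f (j, l, z)) h)
    (c₂ := fun l => Complex.exp (θ l * Complex.I) * inner ℂ (whSystem B Y g (j, l, z)) h')
    (by simpa only [norm_mul, Complex.norm_exp_ofReal_mul_I, one_mul, Function.comp_def] using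
      (hF.summable_norm_inner_sq h).comp_injective hinj)
    (by simpa only [norm_mul, Complex.norm_exp_ofReal_mul_I, one_mul, Function.comp_def] using
      (hG.summable_norm_inner_sq h').comp_injective hinj)
    (fun l => by
      rw [whSystem, inner_modulate_transl, ← mul_assoc, hexp, one_mul])
    (fun l => by
      rw [whSystem, inner_modulate_transl, hθ, ← mul_assoc, hexp, one_mul])
  rw [← key]
  refine tsum_congr fun l => ?_
  have h1 : conj (Complex.exp (θ l * Complex.I)) * Complex.exp (θ l * Complex.I) = 1 := by
    rw [mul_comm, Complex.mul_conj, Complex.normSq_eq_norm_sq, Complex.norm_exp_ofReal_mul_I]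
    simp
  rw [map_mul, mul_mul_mul_comm, h1, one_mul]

end Coefficients

end WeylHeisenberg

end

theorem theorem3 (d n : ℕ) (A X B Y : Matrix (Fin d) (Fin d) ℝ)
    (hA : IsUnit A.det) (hX : IsUnit X.det) (hB : IsUnit B.det) (hY : IsUnit Y.det)
    (f g : Fin n → WeylHeisenberg.L2 d)
    (hF : WeylHeisenberg.IsFrame (WeylHeisenberg.whSystem A X f))
    (hG : WeylHeisenberg.IsFrame (WeylHeisenberg.whSystem B Y g))
    (E F E' F' : Fin n → Set (EuclideanSpace ℝ (Fin d)))
    (hE : ∀ j, E j = WeylHeisenberg.periodSupport X (𝓕 (f j)))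
    (hFj : ∀ j, F j = WeylHeisenberg.periodSupport Y (𝓕 (g j)))
    (hE' : ∀ j, E' j = WeylHeisenberg.periodSupport A (f j))
    (hF' : ∀ j, F' j = WeylHeisenberg.periodSupport B (g j)) :
    (LinearMap.range (WeylHeisenberg.analysis _ hF) ≤
        LinearMap.range (WeylHeisenberg.analysis _ hG) →
      ∀ j, volume (E j \ F j) = 0 ∧ volume (E' j \ F' j) = 0) ∧
    (LinearMap.range (WeylHeisenberg.analysis _ hF) =
        LinearMap.range (WeylHeisenberg.analysis _ hG) →
      ∀ j, volume (symmDiff (E j) (F j)) = 0 ∧ volume (symmDiff (E' j) (F' j)) = 0) ∧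
    ((∀ j, volume (E j ∩ F j) = 0) →
      LinearMap.range (WeylHeisenberg.analysis _ hF) ⟂
        LinearMap.range (WeylHeisenberg.analysis _ hG)) ∧
    (Xᵀ * A = Yᵀ * B → (∀ j, volume (E' j ∩ F' j) = 0) →
      LinearMap.range (WeylHeisenberg.analysis _ hF) ⟂
        LinearMap.range (WeylHeisenberg.analysis _ hG)) := by
  simp only [hE, hFj, hE', hF']
  have h1 := fun hle => WeylHeisenberg.volume_periodSupport_diff_of_range_le
    hA hX hB hY hF hG hle
  have h2 := fun hle => WeylHeisenberg.volume_periodSupport_diff_of_range_le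
    hB hY hA hX hG hF hle
  refine ⟨h1, fun he j => ?_, WeylHeisenberg.range_analysis_isOrtho_of_fourier hX hY hF hG,
    fun hXY => WeylHeisenberg.range_analysis_isOrtho_of_time hA hB hXY hF hG⟩
  rw [Set.symmDiff_def, Set.symmDiff_def]
  exact ⟨measure_union_null (h1 he.le j).1 (h2 he.ge j).1,
    measure_union_null (h1 he.le j).2 (h2 he.ge j).2⟩
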